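/- Let $\mathcal C$ be a triangulated category with suspension $\Sigma$. Let $\xi$ be a proper class of triangles in $\mathcal C$, that is, a class of distinguished triangles that is closed under isomorphisms and finite direct sums, contains all split triangles $A\to B\to C\xrightarrow{0}\Sigma A$, and has the following three properties. - (Base change) If $A\to B\to C\xrightarrow{\delta}\Sigma A$ is in $\xi$ and $c\colon C'\to C$ is a morphism, then every distinguished triangle $A\to B'\to C'\xrightarrow{\delta c}\Sigma A$ is in $\xi$. - (Cobase change) If $A\to B\to C\xrightarrow{\delta}\Sigma A$ is in $\xi$ and $a\colon A\to A'$ is a morphism, then every distinguished triangle $A'\to B'\to C\xrightarrow{(\Sigma a)\delta}\Sigma A'$ is in $\xi$. - (Saturation) If $A_1\to B_1\to C\xrightarrow{\delta_1}\Sigma A_1$ is distinguished, and both $A_2\to B_2\xrightarrow{y_2}C\to\Sigma A_2$ and $A_1\to M\to B_2\xrightarrow{\delta_1y_2}\Sigma A_1$ are in $\xi$, then $A_1\to B_1\to C\xrightarrow{\delta_1}\Sigma A_1$ is in $\xi$. For a class $\mathcal V$ of objects, a triangle $A\to B\to C\to\Sigma A$ in $\xi$ is called $\mathcal C(\mathcal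 V,-)$-exact if $0\to\mathcal C(V,A)\to\mathcal C(V,B)\to\mathcal C(V,C)\to0$ is exact for all $V\in\mathcal V$, and $\mathcal C(-,\mathcal V)$-exact if $0\to\mathcal C(C,V)\to\mathcal C(B,V)\to\mathcal C(A,V)\to0$ is exact for all $V\in\mathcal V$. Let $\mathcal G\mathcal V(\xi)$ be the class of objects $X$ for which there are a complex $(V_n,\,d_n\colon V_n\to V_{n-1})_{n\in\mathbb Z}$ with all $V_n\in\mathcal V$, and triangles $K_{n+1}\xrightarrow{g_n}V_n\xrightarrow{f_n}K_n\to\Sigma K_{n+1}$ $(n\in\mathbb Z)$ in $\xi$ that are both $\mathcal C(\mathcal V,-)$-exact and $\mathcal C(-,\mathcal V)$-exact, such that $d_n=g_{n-1}f_n$ for all $n$ and $K_0\cong X$. Let $\mathcal W$ be an additive full subcategory of $\mathcal C$ (containing $0$ and closed under finite direct sums) that is closed under isomorphisms and $\Sigma$-stable, i.e. $\Sigma(\mathcal W)=\mathcal W$. Put $\mathcal{GW}^1(\xi)=\mathcal{GW}(\xi)$ and $\mathcal{GW}^{n+1}(\xi)=\mathcal G(\mathcal{GW}^n(\xi))(\xi)$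 for $n\ge1$. Then $\mathcal{GW}^n(\xi)=\mathcal{GW}(\xi)$ for all $n\ge1$, and $\mathcal{GW}(\xi)$ is closed under direct summands. -/

import Mathlib

open CategoryTheory CategoryTheory.Limits CategoryTheory.Pretriangulated
open scoped ZeroObject

universe v u

namespace RelGorenstein

section

variable {C : Type u} [Category.{v} C] [Preadditive C] [HasZeroObject C] [HasShift C ℤ]
  [∀ n : ℤ, (shiftFunctor C n).Additive] [Pretriangulated C]

/-- A proper class of (distinguished) triangles. The extension group of a triangulated category is
`𝔼(Z, A) = (Z ⟶ A⟦1⟧)`, with `c^* δ = c ≫ δ` and `a_* δ = δ ≫ a⟦1⟧'`. -/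
structure IsProperClass (ξ : Set (Triangle C)) : Prop where
  /-- every member is a distinguished triangle -/
  distinguished : ∀ T ∈ ξ, T ∈ distTriang C
  /-- closed under isomorphisms -/
  of_iso : ∀ T₁ ∈ ξ, ∀ T₂ : Triangle C, (T₁ ≅ T₂) → T₂ ∈ ξ
  /-- contains all split triangles (in particular the zero triangle) -/
  split : ∀ {A B Z : C} (x : A ⟶ B) (y : B ⟶ Z),
    Triangle.mk x y (0 : Z ⟶ A⟦(1 : ℤ)⟧) ∈ distTriang C →
      Triangle.mk x y (0 : Z ⟶ A⟦(1 : ℤ)⟧) ∈ ξ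
  /-- closed under direct sums; the connecting morphism of the direct sum is `δ₁ ⊞ δ₂` followed by
  the canonical isomorphism `A₁⟦1⟧ ⊞ A₂⟦1⟧ ≅ (A₁ ⊞ A₂)⟦1⟧` -/
  sum : ∀ {A₁ B₁ Z₁ A₂ B₂ Z₂ : C}
    (x₁ : A₁ ⟶ B₁) (y₁ : B₁ ⟶ Z₁) (δ₁ : Z₁ ⟶ A₁⟦(1 : ℤ)⟧)
    (x₂ : A₂ ⟶ B₂) (y₂ : B₂ ⟶ Z₂) (δ₂ : Z₂ ⟶ A₂⟦(1 : ℤ)⟧),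
    Triangle.mk x₁ y₁ δ₁ ∈ ξ → Triangle.mk x₂ y₂ δ₂ ∈ ξ →
      Triangle.mk (biprod.map x₁ x₂) (biprod.map y₁ y₂)
        (biprod.desc (δ₁ ≫ (biprod.inl : A₁ ⟶ A₁ ⊞ A₂)⟦(1 : ℤ)⟧')
          (δ₂ ≫ (biprod.inr : A₂ ⟶ A₁ ⊞ A₂)⟦(1 : ℤ)⟧')) ∈ ξ
  /-- closed under base change -/
  baseChange : ∀ {A B Z : C} (x : A ⟶ B) (y : B ⟶ Z) (δ : Z ⟶ A⟦(1 : ℤ)⟧),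
    Triangle.mk x y δ ∈ ξ →
    ∀ {B' Z' : C} (c : Z' ⟶ Z) (x' : A ⟶ B') (y' : B' ⟶ Z'),
      Triangle.mk x' y' (c ≫ δ) ∈ distTriang C → Triangle.mk x' y' (c ≫ δ) ∈ ξ
  /-- closed under cobase change -/
  cobaseChange : ∀ {A B Z : C} (x : A ⟶ B) (y : B ⟶ Z) (δ : Z ⟶ A⟦(1 : ℤ)⟧),
    Triangle.mk x y δ ∈ ξ →
    ∀ {A' B' : C} (a : A ⟶ A') (x' : A' ⟶ B') (y' : B' ⟶ Z),
      Triangle.mk x' y' (δ ≫ a⟦(1 : ℤ)⟧') ∈ distTriang C →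
        Triangle.mk x' y' (δ ≫ a⟦(1 : ℤ)⟧') ∈ ξ
  /-- saturated: if the base change of `A₁ ⟶ B₁ ⟶ Z` along `y₂ : B₂ ⟶ Z` is in `ξ`, where
  `A₂ ⟶ B₂ ⟶ Z` is in `ξ`, then `A₁ ⟶ B₁ ⟶ Z` is in `ξ` -/
  saturated : ∀ {A₁ B₁ A₂ B₂ M Z : C}
    (x₁ : A₁ ⟶ B₁) (y₁ : B₁ ⟶ Z) (δ₁ : Z ⟶ A₁⟦(1 : ℤ)⟧)
    (x₂ : A₂ ⟶ B₂) (y₂ : B₂ ⟶ Z) (δ₂ : Z ⟶ A₂⟦(1 : ℤ)⟧) (m : A₁ ⟶ M) (e : M ⟶ B₂),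
    Triangle.mk x₁ y₁ δ₁ ∈ distTriang C →
    Triangle.mk x₂ y₂ δ₂ ∈ ξ →
    Triangle.mk m e (y₂ ≫ δ₁) ∈ ξ →
      Triangle.mk x₁ y₁ δ₁ ∈ ξ

/-- `C(𝒲, -)`-exactness of a triangle `A ⟶ B ⟶ Z ⟶ A⟦1⟧` with first two morphisms `x` and `y`:
`0 ⟶ C(W, A) ⟶ C(W, B) ⟶ C(W, Z) ⟶ 0` is exact for all `W` in `𝒲`. -/
def HomFromExact (𝒲 : ObjectProperty C) {A B Z : C} (x : A ⟶ B) (y : B ⟶ Z) : Prop :=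
  ∀ W : C, 𝒲 W →
    Function.Injective (fun a : W ⟶ A => a ≫ x) ∧
    Function.Exact (fun a : W ⟶ A => a ≫ x) (fun b : W ⟶ B => b ≫ y) ∧
    Function.Surjective (fun b : W ⟶ B => b ≫ y)

/-- `C(-, 𝒲)`-exactness of a triangle `A ⟶ B ⟶ Z ⟶ A⟦1⟧` with first two morphisms `x` and `y`:
`0 ⟶ C(Z, W) ⟶ C(B, W) ⟶ C(A, W) ⟶ 0` is exact for all `W` in `𝒲`. -/
def HomToExact (𝒲 : ObjectProperty C) {A B Z : C} (x : A ⟶ B) (y : B ⟶ Z) : Prop :=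
  ∀ W : C, 𝒲 W →
    Function.Injective (fun c : Z ⟶ W => y ≫ c) ∧
    Function.Exact (fun c : Z ⟶ W => y ≫ c) (fun b : B ⟶ W => x ≫ b) ∧
    Function.Surjective (fun b : B ⟶ W => x ≫ b)

/-- Triangles `K (n+1) ⟶ X n ⟶ K n ⟶ (K (n+1))⟦1⟧` in `ξ` exhibiting a complex
`⋯ ⟶ X 1 ⟶ X 0 ⟶ X (-1) ⟶ ⋯` as a `ξ`-exact complex: each differential factors as
`X (n+1) ⟶ K (n+1) ⟶ X n`. -/
structure ExactDecomposition (ξ : Set (Triangle C)) (X : ChainComplex C ℤ) where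
  /-- the objects `K n` -/
  K : ℤ → C
  /-- the first morphisms -/
  g : ∀ n : ℤ, K (n + 1) ⟶ X.X n
  /-- the second morphisms -/
  f : ∀ n : ℤ, X.X n ⟶ K n
  /-- the connecting morphisms -/
  δ : ∀ n : ℤ, K n ⟶ (K (n + 1))⟦(1 : ℤ)⟧
  mem : ∀ n : ℤ, Triangle.mk (g n) (f n) (δ n) ∈ ξ
  d_eq : ∀ n : ℤ, X.d (n + 1) n = f (n + 1) ≫ g n

/-- A complete `𝒲(ξ)`-resolution `⋯ ⟶ W₁ ⟶ W₀ ⟶ W⁰ ⟶ W¹ ⟶ ⋯` of `A`. Here `Wᵢ` sits in degree `i`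
and `Wⁱ` in degree `-1 - i`, so that `A ≅ K 0` is the object through which `W₀ ⟶ W⁰` factors. -/
structure CompleteResolution (ξ : Set (Triangle C)) (𝒲 : ObjectProperty C) (A : C) where
  /-- the complex -/
  X : ChainComplex C ℤ
  /-- its terms lie in `𝒲` -/
  terms : ∀ n : ℤ, 𝒲 (X.X n)
  /-- it is `ξ`-exact -/
  dec : ExactDecomposition ξ X
  /-- it is `C(𝒲, -)`-exact -/
  homFrom : ∀ n : ℤ, HomFromExact 𝒲 (dec.g n) (dec.f n)
  /-- it is `C(-, 𝒲)`-exact -/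
  homTo : ∀ n : ℤ, HomToExact 𝒲 (dec.g n) (dec.f n)
  /-- it resolves `A` -/
  iso : dec.K 0 ≅ A

/-- The Gorenstein subcategory `𝒢𝒲(ξ)`: the objects that admit a complete `𝒲(ξ)`-resolution. -/
def gorenstein (ξ : Set (Triangle C)) (𝒲 : ObjectProperty C) : ObjectProperty C :=
  fun A => Nonempty (CompleteResolution ξ 𝒲 A)

/-- The iterated Gorenstein subcategories `𝒢𝒲ⁿ(ξ)`: `𝒢𝒲¹(ξ) = 𝒢𝒲(ξ)` and
`𝒢𝒲ⁿ⁺¹(ξ) = 𝒢(𝒢𝒲ⁿ(ξ))` for `n ≥ 1` (with the convention `𝒢𝒲⁰(ξ) = 𝒲`). -/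
def gorensteinIter (ξ : Set (Triangle C)) (𝒲 : ObjectProperty C) : ℕ → ObjectProperty C
  | 0 => 𝒲
  | n + 1 => gorenstein ξ (gorensteinIter ξ 𝒲 n)

end

end RelGorenstein

/-!
Since `𝒲` is stable under the shift, a distinguished triangle `A ⟶ B ⟶ Z ⟶ A⟦1⟧` is `C(𝒲, -)`-exact
and `C(-, 𝒲)`-exact if and only if its connecting morphism `δ` is killed by all morphisms from and
to objects of `𝒲` (`homFromExact_iff`, `homToExact_iff`). The triangles of `ξ` with this property
are again closed under base change and cobase change, and they are saturated and cosaturated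
(`IsRelPhantom`). By the octahedral axiom they are the conflations of an extriangulated structure,
in which the objects of `𝒲` are both projective and injective
(`inflationAxioms_exactConf`, `inflationAxioms_opConf_exactConf`).

A complete resolution of `X` is a coresolution of `X` spliced with a resolution of `X`, and the two
halves can be treated separately (`gorenstein_iff`); the second is the first in the opposite
category. Let `𝒦` be the class of objects that have an infinite coresolution by objects of `𝒲`,
defined coinductively (`Coresolvable`).

* `𝒦` is closed under extensions, by the horseshoe lemma (`Coresolvable.of_conf`).
* An object `X` coresolved by objects of `𝒦` lies in `𝒦` (`Coresolvable.of_coresolvable`): compose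
  the first step `X ⟶ G` with `G ⟶ W`, where `W` is in `𝒲`. The cone of the composite is an extension
  of the cone of `G ⟶ W` by that of `X ⟶ G`, and is therefore again coresolved by objects of `𝒦`.
* `𝒦` is closed under direct summands (`Coresolvable.of_split`), by the same composition: the cone of
  `H ⟶ G ⟶ W`, for a summand `H` of `G`, is a summand of an object of `𝒦`.

A triangle that is exact with respect to `𝒢𝒲(ξ)` is exact with respect to the smaller class `𝒲`, so
the second point gives `𝒢(𝒢𝒲(ξ))(ξ) = 𝒢𝒲(ξ)`, and the third gives the closure under summands.
-/

namespace RelGorenstein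

/-! ### Coresolutions in a category with conflations -/

section Conflations

variable {D : Type u} [Category.{v} D]

/-- The half of the axioms of an extriangulated category that concerns inflations, for a class of
pairs of morphisms `A ⟶ B ⟶ Z` called conflations. It is used for a category and its opposite. -/
structure InflationAxioms (Conf : ∀ ⦃A B Z : D⦄, (A ⟶ B) → (B ⟶ Z) → Prop) : Prop where
  /-- a composite of inflations is an inflation, and the cones form a conflation -/
  comp : ∀ {A B Z E F : D} {x : A ⟶ B} {y : B ⟶ Z} {u : B ⟶ E} {w : E ⟶ F},
    Conf x y → Conf u w →
      ∃ (Q : D) (p : E ⟶ Q) (m : Z ⟶ Q) (n : Q ⟶ F), Conf (x ≫ u) p ∧ Conf m n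
  /-- two inflations with the same source have a pushout, and a pushout of a split inflation is
  split -/
  pushout : ∀ {A B Z E F : D} {x : A ⟶ B} {y : B ⟶ Z} {a : A ⟶ E} {a' : E ⟶ F},
    Conf x y → Conf a a' →
      ∃ (P : D) (u : E ⟶ P) (w : P ⟶ Z) (b : B ⟶ P) (p : P ⟶ F), Conf u w ∧ Conf b p ∧
        ((∃ r : E ⟶ A, a ≫ r = 𝟙 A) → ∃ r : P ⟶ B, b ≫ r = 𝟙 B)
  /-- the ends of a split conflation can be exchanged -/
  swap : ∀ {A B Z : D} {x : A ⟶ B} {y : B ⟶ Z}, Conf x y → (∃ r : B ⟶ A, x ≫ r = 𝟙 A) →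
    ∃ (x' : Z ⟶ B) (y' : B ⟶ A), Conf x' y' ∧ ∃ r : B ⟶ Z, x' ≫ r = 𝟙 Z

/-- The objects that admit an infinite coresolution by objects of `𝒲`. The class is defined
coinductively: it is the largest class of objects each of which embeds into an object of `𝒲` with
cone again in the class. -/
def Coresolvable (Conf : ∀ ⦃A B Z : D⦄, (A ⟶ B) → (B ⟶ Z) → Prop) (𝒲 : ObjectProperty D) :
    ObjectProperty D :=
  fun X => ∃ 𝒴 : ObjectProperty D, 𝒴 X ∧ ∀ Y, 𝒴 Y →
    ∃ (W Y' : D) (x : Y ⟶ W) (y : W ⟶ Y'), 𝒲 W ∧ 𝒴 Y' ∧ Conf x y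

variable {Conf : ∀ ⦃A B Z : D⦄, (A ⟶ B) → (B ⟶ Z) → Prop} {𝒲 : ObjectProperty D}

lemma Coresolvable.exists_conf {X : D} (h : Coresolvable Conf 𝒲 X) :
    ∃ (W Y : D) (x : X ⟶ W) (y : W ⟶ Y), 𝒲 W ∧ Coresolvable Conf 𝒲 Y ∧ Conf x y := by
  obtain ⟨𝒴, hX, h𝒴⟩ := h
  obtain ⟨W, Y, x, y, hW, hY, hxy⟩ := h𝒴 X hX
  exact ⟨W, Y, x, y, hW, ⟨𝒴, hY, h𝒴⟩, hxy⟩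

/-- A coresolution spelled out as a sequence of cosyzygies. -/
lemma Coresolvable.exists_seq {X : D} (h : Coresolvable Conf 𝒲 X) :
    ∃ c : ℕ → D, c 0 = X ∧
      ∀ n, ∃ (W : D) (x : c n ⟶ W) (y : W ⟶ c (n + 1)), 𝒲 W ∧ Conf x y := by
  choose W Y x y hW hY hxy using
    fun Z : {Z : D // Coresolvable Conf 𝒲 Z} => Z.2.exists_conf
  let c : ℕ → {Z : D // Coresolvable Conf 𝒲 Z} :=
    fun n => n.rec ⟨X, h⟩ (fun _ Z => ⟨Y Z, hY Z⟩)
  exact ⟨fun n => (c n).1, rfl, fun n => ⟨W (c n), x (c n), y (c n), hW _, hxy _⟩⟩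

/-- The horseshoe lemma: if the objects of `𝒲` are injective and closed under extensions, then
coresolvable objects are closed under extensions. -/
lemma Coresolvable.of_conf (hC : InflationAxioms Conf)
    (hinj : ∀ {A B Z : D} {x : A ⟶ B} {y : B ⟶ Z}, 𝒲 A → Conf x y → ∃ r : B ⟶ A, x ≫ r = 𝟙 A)
    (hext : ∀ {A B Z : D} {x : A ⟶ B} {y : B ⟶ Z}, Conf x y → 𝒲 A → 𝒲 Z → 𝒲 B)
    {A B Z : D} {x : A ⟶ B} {y : B ⟶ Z} (hxy : Conf x y)
    (hA : Coresolvable Conf 𝒲 A) (hZ : Coresolvable Conf 𝒲 Z) : Coresolvable Conf 𝒲 B := by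
  refine ⟨fun B => ∃ (A Z : D) (x : A ⟶ B) (y : B ⟶ Z),
    Coresolvable Conf 𝒲 A ∧ Coresolvable Conf 𝒲 Z ∧ Conf x y, ⟨A, Z, x, y, hA, hZ, hxy⟩, ?_⟩
  rintro B ⟨A, Z, x, y, hA, hZ, hxy⟩
  obtain ⟨V, A', a, a', hV, hA', ha⟩ := hA.exists_conf
  obtain ⟨W, Z', c, c', hW, hZ', hc⟩ := hZ.exists_conf
  obtain ⟨P, u, w, b, p, huw, hbp, -⟩ := hC.pushout hxy ha
  -- `P` is a split extension of `Z` by the injective object `V`, so `Z` embeds into it with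
  -- cone `V`
  obtain ⟨s, t, hst, -⟩ := hC.swap huw (hinj hV huw)
  obtain ⟨Q, u', w', b', p', huw', hbp', -⟩ := hC.pushout hc hst
  obtain ⟨B', q, m, n, hq, hmn⟩ := hC.comp hbp huw'
  exact ⟨Q, B', b ≫ u', q, hext hbp' hW hV, ⟨A', Z', m, n, hA', hZ', hmn⟩, hq⟩

/-- An object that is coresolved by coresolvable objects is coresolvable. -/
lemma Coresolvable.of_coresolvable (hC : InflationAxioms Conf)
    (hinj : ∀ {A B Z : D} {x : A ⟶ B} {y : B ⟶ Z}, 𝒲 A → Conf x y → ∃ r : B ⟶ A, x ≫ r = 𝟙 A)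
    (hext : ∀ {A B Z : D} {x : A ⟶ B} {y : B ⟶ Z}, Conf x y → 𝒲 A → 𝒲 Z → 𝒲 B)
    {X : D} (hX : Coresolvable Conf (Coresolvable Conf 𝒲) X) : Coresolvable Conf 𝒲 X := by
  refine ⟨Coresolvable Conf (Coresolvable Conf 𝒲), hX, fun X hX => ?_⟩
  obtain ⟨G, Y, x, y, hG, hY, hxy⟩ := hX.exists_conf
  obtain ⟨W, G', a, a', hW, hG', ha⟩ := hG.exists_conf
  obtain ⟨X', p, m, n, hp, hmn⟩ := hC.comp hxy ha
  refine ⟨W, X', x ≫ a, p, hW, ?_, hp⟩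
  -- the cone `X'` is an extension of `G'` by `Y`; pushing it out along the first step `Y ⟶ H` of
  -- the coresolution of `Y` embeds it into an extension of `G'` by `H`, with the same cone
  obtain ⟨H, Y', h, h', hH, hY', hh⟩ := hY.exists_conf
  obtain ⟨P, u, w, b, q, huw, hbq, -⟩ := hC.pushout hmn hh
  have hP : Coresolvable Conf 𝒲 P := Coresolvable.of_conf hC hinj hext huw hH hG'
  obtain ⟨𝒴, hY'𝒴, h𝒴⟩ := hY'
  refine ⟨fun Z => Z = X' ∨ 𝒴 Z, Or.inl rfl, ?_⟩
  rintro Z (rfl | hZ)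
  · exact ⟨P, Y', b, q, hP, Or.inr hY'𝒴, hbq⟩
  · obtain ⟨W, Z', x, y, hW, hZ', hxy⟩ := h𝒴 Z hZ
    exact ⟨W, Z', x, y, hW, Or.inr hZ', hxy⟩

/-- Direct summands of coresolvable objects are coresolvable. If `H` is a summand of `G`, embed `G`
into an object `W` of `𝒲`; then the cone of the composite `H ⟶ G ⟶ W` is again a summand of a
coresolvable object. -/
lemma Coresolvable.of_split (hC : InflationAxioms Conf)
    (hinj : ∀ {A B Z : D} {x : A ⟶ B} {y : B ⟶ Z}, 𝒲 A → Conf x y → ∃ r : B ⟶ A, x ≫ r = 𝟙 A)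
    (hext : ∀ {A B Z : D} {x : A ⟶ B} {y : B ⟶ Z}, Conf x y → 𝒲 A → 𝒲 Z → 𝒲 B)
    {H G H' : D} {x : H ⟶ G} {y : G ⟶ H'} (hxy : Conf x y) (hs : ∃ r : G ⟶ H, x ≫ r = 𝟙 H)
    (hG : Coresolvable Conf 𝒲 G) : Coresolvable Conf 𝒲 H := by
  refine ⟨fun H => ∃ (G H' : D) (x : H ⟶ G) (y : G ⟶ H'), Coresolvable Conf 𝒲 G ∧ Conf x y ∧
    ∃ r : G ⟶ H, x ≫ r = 𝟙 H, ⟨G, H', x, y, hG, hxy, hs⟩, ?_⟩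
  rintro H ⟨G, H', x, y, hG, hxy, hs⟩
  obtain ⟨W, G', a, a', hW, hG', ha⟩ := hG.exists_conf
  obtain ⟨K, p, m, n, hp, hmn⟩ := hC.comp hxy ha
  obtain ⟨x', y', hxy', hs'⟩ := hC.swap hxy hs
  -- the cone `K` is an extension of `G'` by `H'`; its pushout `P` along the split inflation
  -- `H' ⟶ G` is an extension of `G'` by `G` and contains `K` as a summand
  obtain ⟨P, u, w, b, q, huw, hbq, hb⟩ := hC.pushout hmn hxy'
  exact ⟨W, K, x ≫ a, p, hW,
    ⟨P, H, b, q, Coresolvable.of_conf hC hinj hext huw hG hG', hbq, hb hs'⟩, hp⟩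

lemma Coresolvable.mono {𝒱 : ObjectProperty D}
    {Conf' : ∀ ⦃A B Z : D⦄, (A ⟶ B) → (B ⟶ Z) → Prop}
    (h : 𝒲 ≤ 𝒱) (h' : ∀ {A B Z : D} {x : A ⟶ B} {y : B ⟶ Z}, Conf x y → Conf' x y)
    {X : D} (hX : Coresolvable Conf 𝒲 X) : Coresolvable Conf' 𝒱 X := by
  obtain ⟨𝒴, hX, h𝒴⟩ := hX
  refine ⟨𝒴, hX, fun Y hY => ?_⟩
  obtain ⟨W, Y', x, y, hW, hY', hxy⟩ := h𝒴 Y hY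
  exact ⟨W, Y', x, y, h _ hW, hY', h' hxy⟩

lemma Coresolvable.of_iso
    (hC : ∀ {A A' B Z : D} {x : A ⟶ B} {y : B ⟶ Z} (e : A' ≅ A), Conf x y → Conf (e.hom ≫ x) y)
    {X X' : D} (e : X' ≅ X) (hX : Coresolvable Conf 𝒲 X) : Coresolvable Conf 𝒲 X' := by
  obtain ⟨𝒴, hX𝒴, h𝒴⟩ := hX
  refine ⟨fun Z => Z = X' ∨ 𝒴 Z, Or.inl rfl, ?_⟩
  rintro Z (rfl | hZ)
  · obtain ⟨W, Z', x, y, hW, hZ', hxy⟩ := h𝒴 X hX𝒴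
    exact ⟨W, Z', e.hom ≫ x, y, hW, Or.inr hZ', hC e hxy⟩
  · obtain ⟨W, Z', x, y, hW, hZ', hxy⟩ := h𝒴 Z hZ
    exact ⟨W, Z', x, y, hW, Or.inr hZ', hxy⟩

/-- Conflations in the opposite category. -/
def opConf (Conf : ∀ ⦃A B Z : D⦄, (A ⟶ B) → (B ⟶ Z) → Prop) :
    ∀ ⦃A B Z : Dᵒᵖ⦄, (A ⟶ B) → (B ⟶ Z) → Prop :=
  fun _ _ _ x y => Conf y.unop x.unop

end Conflations

end RelGorenstein

namespace RelGorenstein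

section Triangulated

variable {C : Type u} [Category.{v} C] [Preadditive C] [HasZeroObject C] [HasShift C ℤ]
  [∀ n : ℤ, (shiftFunctor C n).Additive] [Pretriangulated C]

/-! ### Distinguished triangles -/

lemma rotate_mem_distTriang {A B Z : C} {x : A ⟶ B} {y : B ⟶ Z} {δ : Z ⟶ A⟦(1 : ℤ)⟧}
    (h : Triangle.mk x y δ ∈ distTriang C) : Triangle.mk y δ (-x⟦(1 : ℤ)⟧') ∈ distTriang C :=
  rot_of_distTriang _ h

/-- The suspension of a triangle, with the sign on the connecting morphism only. -/
lemma shift_mem_distTriang_iff {A B Z : C} (x : A ⟶ B) (y : B ⟶ Z) (δ : Z ⟶ A⟦(1 : ℤ)⟧) :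
    Triangle.mk (x⟦(1 : ℤ)⟧') (y⟦(1 : ℤ)⟧') (-δ⟦(1 : ℤ)⟧') ∈ distTriang C ↔
      Triangle.mk x y δ ∈ distTriang C := by
  let e : B⟦(1 : ℤ)⟧ ≅ B⟦(1 : ℤ)⟧ := ⟨-𝟙 _, -𝟙 _, by simp, by simp⟩
  refine (distinguished_iff_of_iso (Triangle.isoMk
    (Triangle.mk (x⟦(1 : ℤ)⟧') (y⟦(1 : ℤ)⟧') (-δ⟦(1 : ℤ)⟧'))
    (Triangle.mk (-x⟦(1 : ℤ)⟧') (-y⟦(1 : ℤ)⟧') (-δ⟦(1 : ℤ)⟧')) (Iso.refl _) e (Iso.refl _)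
    (by simp [e, Triangle.mk]) (by simp [e, Triangle.mk]) (by simp [Triangle.mk]))).trans ?_
  exact ((rotate_distinguished_triangle (Triangle.mk x y δ)).trans
    ((rotate_distinguished_triangle _).trans (rotate_distinguished_triangle _))).symm

/-- A distinguished triangle on suspended objects comes from a distinguished triangle. -/
lemma exists_mem_distTriang_of_shift {A B Z : C} {x : A⟦(1 : ℤ)⟧ ⟶ B⟦(1 : ℤ)⟧}
    {y : B⟦(1 : ℤ)⟧ ⟶ Z⟦(1 : ℤ)⟧} {δ : Z ⟶ A⟦(1 : ℤ)⟧}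
    (h : Triangle.mk x y (-δ⟦(1 : ℤ)⟧') ∈ distTriang C) :
    ∃ (x' : A ⟶ B) (y' : B ⟶ Z), Triangle.mk x' y' δ ∈ distTriang C ∧
      x'⟦(1 : ℤ)⟧' = x ∧ y'⟦(1 : ℤ)⟧' = y := by
  obtain ⟨x', rfl⟩ := (shiftFunctor C (1 : ℤ)).map_surjective x
  obtain ⟨y', rfl⟩ := (shiftFunctor C (1 : ℤ)).map_surjective y
  exact ⟨x', y', (shift_mem_distTriang_iff x' y' δ).1 h, rfl, rfl⟩

lemma retraction_iff_of_distTriang {A B Z : C} {x : A ⟶ B} {y : B ⟶ Z} {δ : Z ⟶ A⟦(1 : ℤ)⟧}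
    (h : Triangle.mk x y δ ∈ distTriang C) : (∃ r : B ⟶ A, x ≫ r = 𝟙 A) ↔ δ = 0 := by
  constructor
  · rintro ⟨r, hr⟩
    have h₀ : δ ≫ x⟦(1 : ℤ)⟧' = 0 := comp_distTriang_mor_zero₃₁ _ h
    have h₁ : x⟦(1 : ℤ)⟧' ≫ r⟦(1 : ℤ)⟧' = 𝟙 _ := by rw [← Functor.map_comp, hr, CategoryTheory.Functor.map_id]
    rw [← Category.comp_id δ, ← h₁, ← Category.assoc, h₀, zero_comp]
  · rintro rfl
    have h₀ : (0 : Z ⟶ A⟦(1 : ℤ)⟧) ≫ (𝟙 A)⟦(1 : ℤ)⟧' = (0 : Z ⟶ 0) ≫ 0 := by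
      rw [zero_comp, zero_comp]
    obtain ⟨r, hr, -⟩ := complete_distinguished_triangle_morphism₂ _ _ h
      (contractible_distinguished A) (𝟙 A) 0 h₀
    exact ⟨r, hr.trans (Category.comp_id _)⟩

lemma section_iff_of_distTriang {A B Z : C} {x : A ⟶ B} {y : B ⟶ Z} {δ : Z ⟶ A⟦(1 : ℤ)⟧}
    (h : Triangle.mk x y δ ∈ distTriang C) : (∃ s : Z ⟶ B, s ≫ y = 𝟙 Z) ↔ δ = 0 := by
  constructor
  · rintro ⟨s, hs⟩
    have h₀ : y ≫ δ = 0 := comp_distTriang_mor_zero₂₃ _ h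
    rw [← Category.id_comp δ, ← hs, Category.assoc, h₀, comp_zero]
  · rintro rfl
    obtain ⟨s, hs⟩ := Triangle.coyoneda_exact₃ _ h (𝟙 Z) (comp_zero (f := 𝟙 Z))
    exact ⟨s, hs.symm⟩

/-- The middle term of a split triangle is the direct sum of the ends. -/
lemma exists_iso_biprod_of_split {A B Z : C} {x : A ⟶ B} {y : B ⟶ Z}
    (h : Triangle.mk x y (0 : Z ⟶ A⟦(1 : ℤ)⟧) ∈ distTriang C) : Nonempty (B ≅ A ⊞ Z) := by
  obtain ⟨e, -, -⟩ := exists_iso_binaryBiproduct_of_distTriang _ h rfl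
  exact ⟨e⟩

/-- The ends of a split triangle can be exchanged. -/
lemma exists_swap_of_split {A B Z : C} {x : A ⟶ B} {y : B ⟶ Z}
    (h : Triangle.mk x y (0 : Z ⟶ A⟦(1 : ℤ)⟧) ∈ distTriang C) :
    ∃ (x' : Z ⟶ B) (y' : B ⟶ A), Triangle.mk x' y' (0 : A ⟶ Z⟦(1 : ℤ)⟧) ∈ distTriang C := by
  obtain ⟨e⟩ := exists_iso_biprod_of_split h
  let e' : B ≅ Z ⊞ A := e ≪≫ biprod.braiding A Z
  refine ⟨biprod.inl ≫ e'.inv, e'.hom ≫ biprod.snd,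
    isomorphic_distinguished _ (binaryBiproductTriangle_distinguished Z A) _
      (Triangle.isoMk _ _ (Iso.refl _) e' (Iso.refl _) ?_ ?_ ?_)⟩
  all_goals simp [binaryBiproductTriangle, Triangle.mk]

variable [IsTriangulated C]

/-- Homotopy pushout of two morphisms out of `A`. -/
lemma exists_homotopy_pushout {A B Z E F : C} {x : A ⟶ B} {y : B ⟶ Z} {δ : Z ⟶ A⟦(1 : ℤ)⟧}
    {a : A ⟶ E} {a' : E ⟶ F} {ε : F ⟶ A⟦(1 : ℤ)⟧}
    (h : Triangle.mk x y δ ∈ distTriang C) (h' : Triangle.mk a a' ε ∈ distTriang C) :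
    ∃ (P : C) (u : E ⟶ P) (w : P ⟶ Z) (b : B ⟶ P) (p : P ⟶ F),
      Triangle.mk u w (δ ≫ a⟦(1 : ℤ)⟧') ∈ distTriang C ∧
      Triangle.mk b p (-(ε ≫ x⟦(1 : ℤ)⟧')) ∈ distTriang C := by
  obtain ⟨P, u, w, huw⟩ := distinguished_cocone_triangle₂ (δ ≫ a⟦(1 : ℤ)⟧')
  have h₁ := rotate_mem_distTriang (rotate_mem_distTriang h)
  have h₂ := (shift_mem_distTriang_iff _ _ _).2 h'
  have h₃ := rotate_mem_distTriang (rotate_mem_distTriang huw)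
  have O := Triangulated.someOctahedron rfl h₁ h₂ h₃
  obtain ⟨b, p, hbp, -, -⟩ := exists_mem_distTriang_of_shift (δ := -(ε ≫ x⟦(1 : ℤ)⟧'))
    (x := O.m₁) (y := O.m₃) (by simpa only [Functor.map_neg, Functor.map_comp, Preadditive.neg_comp, Preadditive.comp_neg,
       neg_neg] using O.mem)
  exact ⟨P, u, w, b, p, huw, hbp⟩

/-- Homotopy pullback of two morphisms into `Z`. -/
lemma exists_homotopy_pullback {A B Z K E : C} {x : A ⟶ B} {y : B ⟶ Z} {δ : Z ⟶ A⟦(1 : ℤ)⟧}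
    {k : K ⟶ E} {c : E ⟶ Z} {ε : Z ⟶ K⟦(1 : ℤ)⟧}
    (h : Triangle.mk x y δ ∈ distTriang C) (h' : Triangle.mk k c ε ∈ distTriang C) :
    ∃ (P : C) (u : A ⟶ P) (w : P ⟶ E) (b : K ⟶ P) (p : P ⟶ B),
      Triangle.mk u w (c ≫ δ) ∈ distTriang C ∧
      Triangle.mk b p (y ≫ ε) ∈ distTriang C := by
  obtain ⟨P, u, w, huw⟩ := distinguished_cocone_triangle₂ (c ≫ δ)
  have h₁ := rotate_mem_distTriang h'
  have h₂ := rotate_mem_distTriang (rotate_mem_distTriang h)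
  have h₃ := rotate_mem_distTriang (rotate_mem_distTriang huw)
  have O := Triangulated.someOctahedron rfl h₁ h₂ h₃
  obtain ⟨b, p, hbp, -, -⟩ := exists_mem_distTriang_of_shift (δ := y ≫ ε)
    (x := O.m₁) (y := O.m₃) (by simpa only [Functor.map_neg, Functor.map_comp, Preadditive.neg_comp, Preadditive.comp_neg,
       neg_neg] using O.mem)
  exact ⟨P, u, w, b, p, huw, hbp⟩

/-- The octahedral axiom for two composable morphisms, in terms of their fibres. -/
lemma exists_fiber_of_comp {K X Y L Z : C} {k : K ⟶ X} {p : X ⟶ Y} {ε : Y ⟶ K⟦(1 : ℤ)⟧}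
    {l : L ⟶ Y} {q : Y ⟶ Z} {θ : Z ⟶ L⟦(1 : ℤ)⟧}
    (h : Triangle.mk k p ε ∈ distTriang C) (h' : Triangle.mk l q θ ∈ distTriang C) :
    ∃ (M : C) (i : M ⟶ X) (ρ : Z ⟶ M⟦(1 : ℤ)⟧) (m : K ⟶ M) (n : M ⟶ L),
      Triangle.mk i (p ≫ q) ρ ∈ distTriang C ∧ Triangle.mk m n (l ≫ ε) ∈ distTriang C ∧
      q ≫ ρ = ε ≫ m⟦(1 : ℤ)⟧' := by
  obtain ⟨M, i, ρ, hi⟩ := distinguished_cocone_triangle₁ (p ≫ q)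
  have O := Triangulated.someOctahedron rfl (rotate_mem_distTriang h) (rotate_mem_distTriang h')
    (rotate_mem_distTriang hi)
  obtain ⟨m, n, hmn, hm, -⟩ := exists_mem_distTriang_of_shift (δ := l ≫ ε)
    (x := O.m₁) (y := O.m₃) (by simpa only [Functor.map_neg, Functor.map_comp, Preadditive.neg_comp, Preadditive.comp_neg,
       neg_neg] using O.mem)
  exact ⟨M, i, ρ, m, n, hi, hmn, (O.comm₁.symm.trans (congrArg (ε ≫ ·) hm.symm))⟩

end Triangulated

end RelGorenstein

namespace RelGorenstein

section Gorenstein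

variable {C : Type u} [Category.{v} C] [Preadditive C] [HasZeroObject C] [HasShift C ℤ]
  [∀ n : ℤ, (shiftFunctor C n).Additive] [Pretriangulated C]

/-! ### Connecting morphisms of exact triangles -/

/-- The connecting morphisms of those triangles in `ξ` that are both `C(𝒲, -)`-exact and
`C(-, 𝒲)`-exact; for `𝒲` stable under the shift, exactness means that the connecting morphism is
killed by all morphisms from and to objects of `𝒲`. -/
structure IsRelPhantom (ξ : Set (Triangle C)) (𝒲 : ObjectProperty C) {Z A : C}
    (δ : Z ⟶ A⟦(1 : ℤ)⟧) : Prop where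
  mem : ∀ {B : C} (x : A ⟶ B) (y : B ⟶ Z), Triangle.mk x y δ ∈ distTriang C →
    Triangle.mk x y δ ∈ ξ
  from_eq_zero : ∀ {W : C} (w : W ⟶ Z), 𝒲 W → w ≫ δ = 0
  to_eq_zero : ∀ {W : C} (w : A⟦(1 : ℤ)⟧ ⟶ W), 𝒲 W → δ ≫ w = 0

variable {ξ : Set (Triangle C)} {𝒲 : ObjectProperty C}

namespace IsRelPhantom

lemma mem_of_exists (hξ : IsProperClass ξ) {A B Z : C} {x : A ⟶ B} {y : B ⟶ Z}
    {δ : Z ⟶ A⟦(1 : ℤ)⟧} (h : Triangle.mk x y δ ∈ ξ) {B' : C} (x' : A ⟶ B') (y' : B' ⟶ Z)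
    (h' : Triangle.mk x' y' δ ∈ distTriang C) : Triangle.mk x' y' δ ∈ ξ := by
  have h₁ := hξ.baseChange x y δ h (𝟙 Z) x' y'
  rw [Category.id_comp] at h₁
  exact h₁ h'

lemma precomp (hξ : IsProperClass ξ) {Z A Z' : C} {δ : Z ⟶ A⟦(1 : ℤ)⟧} (h : IsRelPhantom ξ 𝒲 δ)
    (c : Z' ⟶ Z) : IsRelPhantom ξ 𝒲 (c ≫ δ) where
  mem x' y' h' := by
    obtain ⟨B, x, y, hxy⟩ := distinguished_cocone_triangle₂ δ
    exact hξ.baseChange x y δ (h.mem _ _ hxy) c x' y' h'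
  from_eq_zero w hW := by rw [← Category.assoc, h.from_eq_zero _ hW]
  to_eq_zero w hW := by rw [Category.assoc, h.to_eq_zero _ hW, comp_zero]

lemma postcomp (hξ : IsProperClass ξ) {Z A A' : C} {δ : Z ⟶ A⟦(1 : ℤ)⟧} (h : IsRelPhantom ξ 𝒲 δ)
    (a : A ⟶ A') : IsRelPhantom ξ 𝒲 (δ ≫ a⟦(1 : ℤ)⟧') where
  mem x' y' h' := by
    obtain ⟨B, x, y, hxy⟩ := distinguished_cocone_triangle₂ δ
    exact hξ.cobaseChange x y δ (h.mem _ _ hxy) a x' y' h'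
  from_eq_zero w hW := by rw [← Category.assoc, h.from_eq_zero _ hW, zero_comp]
  to_eq_zero w hW := by rw [Category.assoc, h.to_eq_zero _ hW]

lemma neg (hξ : IsProperClass ξ) {Z A : C} {δ : Z ⟶ A⟦(1 : ℤ)⟧} (h : IsRelPhantom ξ 𝒲 δ) :
    IsRelPhantom ξ 𝒲 (-δ) := by
  simpa using h.precomp hξ (-𝟙 Z)

lemma zero (hξ : IsProperClass ξ) (Z A : C) : IsRelPhantom ξ 𝒲 (0 : Z ⟶ A⟦(1 : ℤ)⟧) where
  mem x y h := hξ.split x y h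
  from_eq_zero _ _ := comp_zero
  to_eq_zero _ _ := zero_comp

/-- Saturation of the class of exact triangles. -/
lemma of_precomp (hξ : IsProperClass ξ) {A₁ A₂ B₂ Z : C} {δ₁ : Z ⟶ A₁⟦(1 : ℤ)⟧}
    {x₂ : A₂ ⟶ B₂} {y₂ : B₂ ⟶ Z} {δ₂ : Z ⟶ A₂⟦(1 : ℤ)⟧}
    (h₂ : Triangle.mk x₂ y₂ δ₂ ∈ distTriang C) (h₂' : IsRelPhantom ξ 𝒲 δ₂)
    (h : IsRelPhantom ξ 𝒲 (y₂ ≫ δ₁)) : IsRelPhantom ξ 𝒲 δ₁ where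
  mem x₁ y₁ h₁ := by
    obtain ⟨M, m, e, hM⟩ := distinguished_cocone_triangle₂ (y₂ ≫ δ₁)
    exact hξ.saturated x₁ y₁ δ₁ x₂ y₂ δ₂ m e h₁ (h₂'.mem _ _ h₂) (h.mem _ _ hM)
  from_eq_zero w hW := by
    obtain ⟨v, hv⟩ : ∃ v, w = v ≫ y₂ :=
      Triangle.coyoneda_exact₃ _ h₂ w (h₂'.from_eq_zero w hW)
    rw [hv, Category.assoc, h.from_eq_zero v hW]
  to_eq_zero w hW := by
    obtain ⟨v, hv⟩ := Triangle.yoneda_exact₃ _ h₂ (δ₁ ≫ w)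
      ((Category.assoc _ _ _).symm.trans (h.to_eq_zero w hW))
    exact hv.trans (h₂'.to_eq_zero v hW)

/-- The dual of saturation. It follows from saturation: the base change of `δ` along the second
morphism of the triangle on `δ ≫ a⟦1⟧'` factors through `ε`. -/
lemma of_postcomp (hξ : IsProperClass ξ) {A Z E F : C} {δ : Z ⟶ A⟦(1 : ℤ)⟧}
    {a : A ⟶ E} {a' : E ⟶ F} {ε : F ⟶ A⟦(1 : ℤ)⟧}
    (ha : Triangle.mk a a' ε ∈ distTriang C) (hε : IsRelPhantom ξ 𝒲 ε)
    (h : IsRelPhantom ξ 𝒲 (δ ≫ a⟦(1 : ℤ)⟧')) : IsRelPhantom ξ 𝒲 δ := by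
  obtain ⟨Y, x, y, hxy⟩ := distinguished_cocone_triangle₂ (δ ≫ a⟦(1 : ℤ)⟧')
  obtain ⟨t, ht⟩ := Triangle.coyoneda_exact₁ _ ha (y ≫ δ)
    ((Category.assoc _ _ _).trans (comp_distTriang_mor_zero₂₃ _ hxy))
  refine of_precomp hξ hxy h ?_
  rw [show y ≫ δ = t ≫ ε from ht]
  exact hε.precomp hξ t

end IsRelPhantom

lemma homFromExact_iff [𝒲.IsStableUnderShift ℤ] {A B Z : C} {x : A ⟶ B} {y : B ⟶ Z}
    {δ : Z ⟶ A⟦(1 : ℤ)⟧} (h : Triangle.mk x y δ ∈ distTriang C) :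
    HomFromExact 𝒲 x y ↔ ∀ {W : C} (w : W ⟶ Z), 𝒲 W → w ≫ δ = 0 := by
  have hxy : x ≫ y = 0 := comp_distTriang_mor_zero₁₂ _ h
  have hyδ : y ≫ δ = 0 := comp_distTriang_mor_zero₂₃ _ h
  constructor
  · intro H W w hW
    obtain ⟨b, hb⟩ := (H W hW).2.2 w
    rw [← show b ≫ y = w from hb, Category.assoc, hyδ, comp_zero]
  · intro H W hW
    refine ⟨fun a a' haa' => ?_, fun b => ⟨fun hb => ?_, ?_⟩, fun w => ?_⟩
    · -- the shift of `a - a'` factors through `δ`, by a morphism whose source `W⟦1⟧` lies in `𝒲`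
      apply (shiftFunctor C (1 : ℤ)).map_injective
      rw [← sub_eq_zero]
      have h₀ : (a⟦(1 : ℤ)⟧' - a'⟦(1 : ℤ)⟧') ≫ x⟦(1 : ℤ)⟧' = 0 := by
        rw [Preadditive.sub_comp, ← Functor.map_comp, ← Functor.map_comp,
          show a ≫ x = a' ≫ x from haa', sub_self]
      obtain ⟨t, ht⟩ := Triangle.coyoneda_exact₁ _ h (a⟦(1 : ℤ)⟧' - a'⟦(1 : ℤ)⟧') h₀
      exact ht.trans (H t (𝒲.le_shift (1 : ℤ) W hW))
    · obtain ⟨a, ha⟩ := Triangle.coyoneda_exact₂ _ h b hb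
      exact ⟨a, ha.symm⟩
    · rintro ⟨a, rfl⟩
      simp [hxy]
    · obtain ⟨b, hb⟩ := Triangle.coyoneda_exact₃ _ h w (H w hW)
      exact ⟨b, hb.symm⟩

lemma homToExact_iff [𝒲.IsStableUnderShift ℤ] {A B Z : C}
    {x : A ⟶ B} {y : B ⟶ Z} {δ : Z ⟶ A⟦(1 : ℤ)⟧} (h : Triangle.mk x y δ ∈ distTriang C) :
    HomToExact 𝒲 x y ↔ ∀ {W : C} (w : A⟦(1 : ℤ)⟧ ⟶ W), 𝒲 W → δ ≫ w = 0 := by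
  have hxy : x ≫ y = 0 := comp_distTriang_mor_zero₁₂ _ h
  have hδx : δ ≫ x⟦(1 : ℤ)⟧' = 0 := comp_distTriang_mor_zero₃₁ _ h
  constructor
  · intro H W w hW
    -- write `w` as the shift of a morphism `a : A ⟶ W⟦-1⟧` and extend `a` to `B`
    let e : (W⟦(-1 : ℤ)⟧)⟦(1 : ℤ)⟧ ≅ W := (shiftEquiv C (1 : ℤ)).counitIso.app W
    obtain ⟨a, ha⟩ := (shiftFunctor C (1 : ℤ)).map_surjective (w ≫ e.inv)
    obtain ⟨b, hb⟩ := (H _ (𝒲.le_shift (-1 : ℤ) W hW)).2.2 a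
    rw [← cancel_mono e.inv, Category.assoc, ← ha, ← show x ≫ b = a from hb, Functor.map_comp,
      ← Category.assoc, hδx, zero_comp, zero_comp]
  · intro H W hW
    refine ⟨fun c c' hcc' => ?_, fun b => ⟨fun hb => ?_, ?_⟩, fun a => ?_⟩
    · rw [← sub_eq_zero]
      have h₀ : y ≫ (c - c') = 0 := by
        rw [Preadditive.comp_sub, show y ≫ c = y ≫ c' from hcc', sub_self]
      obtain ⟨d, hd⟩ := Triangle.yoneda_exact₃ _ h (c - c') h₀
      exact hd.trans (H d hW)
    · obtain ⟨c, hc⟩ := Triangle.yoneda_exact₂ _ h b hb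
      exact ⟨c, hc.symm⟩
    · rintro ⟨c, rfl⟩
      simp [reassoc_of% hxy]
    · -- the shift of `a` kills `δ`, so it extends along `x⟦1⟧'`
      obtain ⟨b', hb⟩ : ∃ b' : B⟦(1 : ℤ)⟧ ⟶ W⟦(1 : ℤ)⟧, a⟦(1 : ℤ)⟧' = (-x⟦(1 : ℤ)⟧') ≫ b' :=
        Triangle.yoneda_exact₃ _ (rotate_mem_distTriang h) (a⟦(1 : ℤ)⟧')
          (H _ (𝒲.le_shift (1 : ℤ) W hW))
      obtain ⟨b, rfl⟩ := (shiftFunctor C (1 : ℤ)).map_surjective b'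
      refine ⟨-b, (shiftFunctor C (1 : ℤ)).map_injective ?_⟩
      simp [hb]

/-! ### Exact triangles as conflations -/

/-- The pairs of morphisms `A ⟶ B ⟶ Z` that are part of a triangle in `ξ` which is `C(𝒱, -)`-exact
and `C(-, 𝒱)`-exact. -/
def ExactConf (ξ : Set (Triangle C)) (𝒱 : ObjectProperty C) :
    ∀ ⦃A B Z : C⦄, (A ⟶ B) → (B ⟶ Z) → Prop :=
  fun A _ Z x y => ∃ δ : Z ⟶ A⟦(1 : ℤ)⟧,
    Triangle.mk x y δ ∈ ξ ∧ HomFromExact 𝒱 x y ∧ HomToExact 𝒱 x y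

omit [HasZeroObject C] [∀ n : ℤ, (shiftFunctor C n).Additive] [Pretriangulated C] in
lemma ExactConf.anti {𝒱 : ObjectProperty C} (h : 𝒲 ≤ 𝒱) {A B Z : C} {x : A ⟶ B} {y : B ⟶ Z}
    (hxy : ExactConf ξ 𝒱 x y) : ExactConf ξ 𝒲 x y := by
  obtain ⟨δ, hδ, h₁, h₂⟩ := hxy
  exact ⟨δ, hδ, fun W hW => h₁ W (h W hW), fun W hW => h₂ W (h W hW)⟩

lemma exactConf_iff (hξ : IsProperClass ξ) [𝒲.IsStableUnderShift ℤ] {A B Z : C} {x : A ⟶ B}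
    {y : B ⟶ Z} : ExactConf ξ 𝒲 x y ↔
      ∃ δ : Z ⟶ A⟦(1 : ℤ)⟧, Triangle.mk x y δ ∈ distTriang C ∧ IsRelPhantom ξ 𝒲 δ := by
  constructor
  · rintro ⟨δ, hδ, h₁, h₂⟩
    have h := hξ.distinguished _ hδ
    exact ⟨δ, h, fun _ _ h' => IsRelPhantom.mem_of_exists hξ hδ _ _ h',
      (homFromExact_iff h).1 h₁, (homToExact_iff h).1 h₂⟩
  · rintro ⟨δ, h, hδ⟩
    exact ⟨δ, hδ.mem _ _ h, (homFromExact_iff h).2 hδ.from_eq_zero,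
      (homToExact_iff h).2 hδ.to_eq_zero⟩

section Shift

variable [𝒲.IsStableUnderShift ℤ]

lemma ExactConf.iso_comp (hξ : IsProperClass ξ) {A A' B Z : C} {x : A ⟶ B} {y : B ⟶ Z}
    (e : A' ≅ A) (h : ExactConf ξ 𝒲 x y) : ExactConf ξ 𝒲 (e.hom ≫ x) y := by
  rw [exactConf_iff hξ] at h ⊢
  obtain ⟨δ, hxy, hδ⟩ := h
  refine ⟨δ ≫ e.inv⟦(1 : ℤ)⟧', isomorphic_distinguished _ hxy _
    (Triangle.isoMk _ _ e (Iso.refl _) (Iso.refl _) ?_ ?_ ?_), hδ.postcomp hξ e.inv⟩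
  · simp [Triangle.mk]
  · simp [Triangle.mk]
  · simp [Triangle.mk, ← Functor.map_comp]

lemma ExactConf.comp_iso (hξ : IsProperClass ξ) {A B Z Z' : C} {x : A ⟶ B} {y : B ⟶ Z}
    (e : Z ≅ Z') (h : ExactConf ξ 𝒲 x y) : ExactConf ξ 𝒲 x (y ≫ e.hom) := by
  rw [exactConf_iff hξ] at h ⊢
  obtain ⟨δ, hxy, hδ⟩ := h
  refine ⟨e.inv ≫ δ, isomorphic_distinguished _ hxy _
    (Triangle.isoMk _ _ (Iso.refl _) (Iso.refl _) e.symm ?_ ?_ ?_), hδ.precomp hξ e.inv⟩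
  all_goals simp [Triangle.mk]

lemma ExactConf.op_iso_comp (hξ : IsProperClass ξ) {A A' B Z : Cᵒᵖ} {x : A ⟶ B} {y : B ⟶ Z}
    (e : A' ≅ A) (h : opConf (ExactConf ξ 𝒲) x y) : opConf (ExactConf ξ 𝒲) (e.hom ≫ x) y :=
  ExactConf.comp_iso hξ e.unop h

lemma ExactConf.exists_retraction (hξ : IsProperClass ξ) {A B Z : C} {x : A ⟶ B} {y : B ⟶ Z}
    (hA : 𝒲 A) (h : ExactConf ξ 𝒲 x y) : ∃ r : B ⟶ A, x ≫ r = 𝟙 A := by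
  obtain ⟨δ, hxy, hδ⟩ := (exactConf_iff hξ).1 h
  refine (retraction_iff_of_distTriang hxy).2 ?_
  simpa using hδ.to_eq_zero (𝟙 _) (𝒲.le_shift (1 : ℤ) A hA)

lemma ExactConf.exists_section (hξ : IsProperClass ξ) {A B Z : C} {x : A ⟶ B} {y : B ⟶ Z}
    (hZ : 𝒲 Z) (h : ExactConf ξ 𝒲 x y) : ∃ s : Z ⟶ B, s ≫ y = 𝟙 Z := by
  obtain ⟨δ, hxy, hδ⟩ := (exactConf_iff hξ).1 h
  refine (section_iff_of_distTriang hxy).2 ?_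
  simpa using hδ.from_eq_zero (𝟙 _) hZ

lemma ExactConf.op_exists_retraction (hξ : IsProperClass ξ) {A B Z : Cᵒᵖ} {x : A ⟶ B} {y : B ⟶ Z}
    (hA : 𝒲.op A) (h : opConf (ExactConf ξ 𝒲) x y) : ∃ r : B ⟶ A, x ≫ r = 𝟙 A := by
  obtain ⟨s, hs⟩ := ExactConf.exists_section hξ hA h
  exact ⟨s.op, congrArg Quiver.Hom.op hs⟩

lemma ExactConf.prop_middle (hξ : IsProperClass ξ) [𝒲.IsClosedUnderIsomorphisms]
    (h_sum : ∀ X Y : C, 𝒲 X → 𝒲 Y → 𝒲 (X ⊞ Y)) {A B Z : C} {x : A ⟶ B} {y : B ⟶ Z}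
    (h : ExactConf ξ 𝒲 x y) (hA : 𝒲 A) (hZ : 𝒲 Z) : 𝒲 B := by
  have hr := h.exists_retraction hξ hA
  obtain ⟨δ, hxy, -⟩ := (exactConf_iff hξ).1 h
  obtain rfl := (retraction_iff_of_distTriang hxy).1 hr
  obtain ⟨e⟩ := exists_iso_biprod_of_split hxy
  exact 𝒲.prop_of_iso e.symm (h_sum A Z hA hZ)

variable [IsTriangulated C]

lemma inflationAxioms_exactConf (hξ : IsProperClass ξ) : InflationAxioms (ExactConf ξ 𝒲) where
  comp {A B Z E F x y u w} hxy huw := by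
    obtain ⟨δ, hxy, hδ⟩ := (exactConf_iff hξ).1 hxy
    obtain ⟨ε, huw, hε⟩ := (exactConf_iff hξ).1 huw
    obtain ⟨Q, p, θ, hθ⟩ := distinguished_cocone_triangle (x ≫ u)
    have O := Triangulated.someOctahedron rfl hxy huw hθ
    refine ⟨Q, p, O.m₁, O.m₃, (exactConf_iff hξ).2 ⟨θ, hθ, ?_⟩,
      (exactConf_iff hξ).2 ⟨_, O.mem, hε.postcomp hξ y⟩⟩
    refine IsRelPhantom.of_postcomp hξ hxy hδ ?_
    rw [O.comm₄]
    exact hε.precomp hξ _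
  pushout {A B Z E F x y a a'} hxy ha := by
    obtain ⟨δ, hxy, hδ⟩ := (exactConf_iff hξ).1 hxy
    obtain ⟨ε, ha, hε⟩ := (exactConf_iff hξ).1 ha
    obtain ⟨P, u, w, b, p, huw, hbp⟩ := exists_homotopy_pushout hxy ha
    refine ⟨P, u, w, b, p, (exactConf_iff hξ).2 ⟨_, huw, hδ.postcomp hξ a⟩,
      (exactConf_iff hξ).2 ⟨_, hbp, (hε.postcomp hξ x).neg hξ⟩, fun hr => ?_⟩
    rw [retraction_iff_of_distTriang ha] at hr
    rw [retraction_iff_of_distTriang hbp, hr, zero_comp, neg_zero]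
  swap {A B Z x y} hxy hr := by
    obtain ⟨δ, hxy, -⟩ := (exactConf_iff hξ).1 hxy
    obtain rfl := (retraction_iff_of_distTriang hxy).1 hr
    obtain ⟨x', y', h⟩ := exists_swap_of_split hxy
    exact ⟨x', y', (exactConf_iff hξ).2 ⟨_, h, .zero hξ _ _⟩,
      (retraction_iff_of_distTriang h).2 rfl⟩

lemma inflationAxioms_opConf_exactConf (hξ : IsProperClass ξ) :
    InflationAxioms (opConf (ExactConf ξ 𝒲)) where
  comp {A B Z E F x y u w} hxy huw := by
    obtain ⟨δ, hxy, hδ⟩ := (exactConf_iff hξ).1 hxy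
    obtain ⟨ε, huw, hε⟩ := (exactConf_iff hξ).1 huw
    obtain ⟨M, i, ρ, m, n, hi, hmn, hρ⟩ := exists_fiber_of_comp huw hxy
    refine ⟨.op M, i.op, n.op, m.op, (exactConf_iff hξ).2 ⟨ρ, hi, ?_⟩,
      (exactConf_iff hξ).2 ⟨_, hmn, hε.precomp hξ _⟩⟩
    refine IsRelPhantom.of_precomp hξ hxy hδ ?_
    rw [hρ]
    exact hε.postcomp hξ m
  pushout {A B Z E F x y a a'} hxy ha := by
    obtain ⟨δ, hxy, hδ⟩ := (exactConf_iff hξ).1 hxy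
    obtain ⟨ε, ha, hε⟩ := (exactConf_iff hξ).1 ha
    obtain ⟨P, u, w, b, p, huw, hbp⟩ := exists_homotopy_pullback hxy ha
    refine ⟨.op P, w.op, u.op, p.op, b.op, (exactConf_iff hξ).2 ⟨_, huw, hδ.precomp hξ _⟩,
      (exactConf_iff hξ).2 ⟨_, hbp, hε.precomp hξ _⟩, ?_⟩
    rintro ⟨r, hr⟩
    have hε₀ := (section_iff_of_distTriang ha).1 ⟨r.unop, congrArg Quiver.Hom.unop hr⟩
    obtain ⟨s, hs⟩ := (section_iff_of_distTriang hbp).2 (by rw [hε₀, comp_zero])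
    exact ⟨s.op, congrArg Quiver.Hom.op hs⟩
  swap {A B Z x y} hxy hr := by
    obtain ⟨δ, hxy, -⟩ := (exactConf_iff hξ).1 hxy
    obtain ⟨r, hr⟩ := hr
    obtain rfl := (section_iff_of_distTriang hxy).1 ⟨r.unop, congrArg Quiver.Hom.unop hr⟩
    obtain ⟨x', y', h⟩ := exists_swap_of_split hxy
    obtain ⟨s, hs⟩ := (section_iff_of_distTriang h).2 rfl
    exact ⟨y'.op, x'.op, (exactConf_iff hξ).2 ⟨_, h, .zero hξ _ _⟩,
      s.op, congrArg Quiver.Hom.op hs⟩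

end Shift

/-! ### Complete resolutions -/

/-- The coresolution and the resolution of an object splice to a complete resolution. -/
lemma gorenstein_of_coresolvable (hξ : IsProperClass ξ) {X : C}
    (h : Coresolvable (ExactConf ξ 𝒲) 𝒲 X)
    (h' : Coresolvable (opConf (ExactConf ξ 𝒲)) 𝒲.op (.op X)) : gorenstein ξ 𝒲 X := by
  obtain ⟨c, hc₀, hc⟩ := h.exists_seq
  obtain ⟨r, hr₀, hr⟩ := h'.exists_seq
  let K : ℤ → C := fun n => match n with
    | .ofNat n => (r n).unop
    | .negSucc n => c (n + 1)
  have hK : ∀ n : ℤ, ∃ (W : C) (g : K (n + 1) ⟶ W) (f : W ⟶ K n), 𝒲 W ∧ ExactConf ξ 𝒲 g f := by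
    rintro (n | n | n)
    · obtain ⟨W, x, y, hW, hxy⟩ := hr n
      exact ⟨W.unop, y.unop, x.unop, hW, hxy⟩
    · have h₀ : (r 0).unop = c 0 := by rw [hr₀, hc₀]
      change ∃ (W : C) (g : (r 0).unop ⟶ W) (f : W ⟶ c (0 + 1)), 𝒲 W ∧ ExactConf ξ 𝒲 g f
      rw [h₀]
      exact hc 0
    · exact hc (n + 1)
  choose W g f hW hgf using hK
  choose δ hδ hfrom hto using hgf
  have hzero : ∀ n, (f (n + 1 + 1) ≫ g (n + 1)) ≫ (f (n + 1) ≫ g n) = 0 := fun n => by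
    have h₀ : g (n + 1) ≫ f (n + 1) = 0 :=
      comp_distTriang_mor_zero₁₂ _ (hξ.distinguished _ (hδ (n + 1)))
    rw [Category.assoc, reassoc_of% h₀, zero_comp, comp_zero]
  exact ⟨{
    X := ChainComplex.of W (fun n => f (n + 1) ≫ g n) hzero
    terms := hW
    dec :=
      { K := K
        g := g
        f := f
        δ := δ
        mem := hδ
        d_eq := fun n => ChainComplex.of_d W (fun n => f (n + 1) ≫ g n) n }
    homFrom := hfrom
    homTo := hto
    iso := eqToIso (congrArg Opposite.unop hr₀) }⟩

omit [HasZeroObject C] [∀ n : ℤ, (shiftFunctor C n).Additive] [Pretriangulated C] in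
/-- Each half of a complete resolution is a coresolution or a resolution. -/
lemma CompleteResolution.coresolvable {X : C} (R : CompleteResolution ξ 𝒲 X) :
    Coresolvable (ExactConf ξ 𝒲) 𝒲 (R.dec.K 0) ∧
      Coresolvable (opConf (ExactConf ξ 𝒲)) 𝒲.op (.op (R.dec.K 0)) := by
  refine ⟨⟨fun Y => ∃ n, Y = R.dec.K n, ⟨0, rfl⟩, ?_⟩,
    ⟨fun Y => ∃ n, Y = .op (R.dec.K n), ⟨0, rfl⟩, ?_⟩⟩
  · rintro Y ⟨n, rfl⟩
    obtain ⟨n, rfl⟩ : ∃ m, n = m + 1 := ⟨n - 1, by ring⟩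
    exact ⟨_, _, R.dec.g n, R.dec.f n, R.terms n, ⟨n, rfl⟩,
      R.dec.δ n, R.dec.mem n, R.homFrom n, R.homTo n⟩
  · rintro Y ⟨n, rfl⟩
    exact ⟨_, _, (R.dec.f n).op, (R.dec.g n).op, R.terms n, ⟨n + 1, rfl⟩,
      R.dec.δ n, R.dec.mem n, R.homFrom n, R.homTo n⟩

lemma gorenstein_iff (hξ : IsProperClass ξ) [𝒲.IsStableUnderShift ℤ] {X : C} :
    gorenstein ξ 𝒲 X ↔ Coresolvable (ExactConf ξ 𝒲) 𝒲 X ∧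
      Coresolvable (opConf (ExactConf ξ 𝒲)) 𝒲.op (.op X) := by
  refine ⟨?_, fun h => gorenstein_of_coresolvable hξ h.1 h.2⟩
  rintro ⟨R⟩
  exact ⟨R.coresolvable.1.of_iso (fun e h => h.iso_comp hξ e) R.iso.symm,
    R.coresolvable.2.of_iso (fun e h => ExactConf.op_iso_comp hξ e h) R.iso.symm.op.symm⟩

lemma exactConf_id_zero (hξ : IsProperClass ξ) (X : C) :
    ExactConf ξ 𝒲 (𝟙 X) (0 : X ⟶ 0) := by
  refine ⟨0, hξ.split _ _ (contractible_distinguished X), fun W _ => ⟨?_, ?_, ?_⟩,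
    fun W _ => ⟨?_, ?_, ?_⟩⟩
  · exact fun a b h => by simpa using h
  · exact fun b => ⟨fun _ => ⟨b, by simp⟩, fun _ => by simp⟩
  · exact fun b => ⟨0, (isZero_zero C).eq_of_tgt _ _⟩
  · exact fun a b _ => (isZero_zero C).eq_of_src _ _
  · exact fun b => ⟨fun hb => ⟨0, by simpa using hb.symm⟩, by rintro ⟨c, rfl⟩; simp⟩
  · exact fun b => ⟨b, by simp⟩

lemma exactConf_zero_id (hξ : IsProperClass ξ) (X : C) :
    ExactConf ξ 𝒲 (0 : 0 ⟶ X) (𝟙 X) := by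
  refine ⟨0, hξ.split _ _ (contractible_distinguished₁ X), fun W _ => ⟨?_, ?_, ?_⟩,
    fun W _ => ⟨?_, ?_, ?_⟩⟩
  · exact fun a b _ => (isZero_zero C).eq_of_tgt _ _
  · exact fun b => ⟨fun hb => ⟨0, by simpa using hb.symm⟩, by rintro ⟨c, rfl⟩; simp⟩
  · exact fun b => ⟨b, by simp⟩
  · exact fun a b h => by simpa using h
  · exact fun b => ⟨fun _ => ⟨b, by simp⟩, fun _ => by simp⟩
  · exact fun b => ⟨0, (isZero_zero C).eq_of_src _ _⟩

/-- The complete resolution of an object of `𝒲` by itself. -/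
lemma le_gorenstein (hξ : IsProperClass ξ) (h_zero : 𝒲 (0 : C)) : 𝒲 ≤ gorenstein ξ 𝒲 :=
  fun _ hX => gorenstein_of_coresolvable hξ
    ⟨𝒲, hX, fun Y hY => ⟨Y, 0, 𝟙 Y, 0, hY, h_zero, exactConf_id_zero hξ Y⟩⟩
    ⟨𝒲.op, hX, fun Y hY => ⟨Y, .op 0, 𝟙 Y, (0 : 0 ⟶ Y.unop).op, hY, h_zero,
      exactConf_zero_id hξ Y.unop⟩⟩

section

variable [IsTriangulated C] [𝒲.IsStableUnderShift ℤ] [𝒲.IsClosedUnderIsomorphisms]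

/-- The Gorenstein construction is idempotent. -/
lemma gorenstein_gorenstein (hξ : IsProperClass ξ) (h_zero : 𝒲 (0 : C))
    (h_sum : ∀ X Y : C, 𝒲 X → 𝒲 Y → 𝒲 (X ⊞ Y)) :
    gorenstein ξ (gorenstein ξ 𝒲) = gorenstein ξ 𝒲 := by
  have hle : 𝒲 ≤ gorenstein ξ 𝒲 := le_gorenstein hξ h_zero
  refine le_antisymm ?_ (le_gorenstein hξ (hle _ h_zero))
  rintro X ⟨R⟩
  refine (gorenstein_iff hξ).2 ⟨?_, ?_⟩
  · have h : Coresolvable (ExactConf ξ 𝒲) (Coresolvable (ExactConf ξ 𝒲) 𝒲) (R.dec.K 0) :=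
      R.coresolvable.1.mono (fun Y hY => ((gorenstein_iff hξ).1 hY).1) (fun h => h.anti hle)
    exact (h.of_coresolvable (inflationAxioms_exactConf hξ)
      (fun hA h => h.exists_retraction hξ hA)
      (fun h hA hZ => h.prop_middle hξ h_sum hA hZ)).of_iso
      (fun e h => h.iso_comp hξ e) R.iso.symm
  · have h : Coresolvable (opConf (ExactConf ξ 𝒲))
        (Coresolvable (opConf (ExactConf ξ 𝒲)) 𝒲.op) (.op (R.dec.K 0)) :=
      R.coresolvable.2.mono (fun Y hY => ((gorenstein_iff hξ).1 hY).2)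
        (fun h => ExactConf.anti hle h)
    exact (h.of_coresolvable (inflationAxioms_opConf_exactConf hξ)
      (fun hA h => ExactConf.op_exists_retraction hξ hA h)
      (fun h hA hZ => ExactConf.prop_middle hξ h_sum h hZ hA)).of_iso
      (fun e h => ExactConf.op_iso_comp hξ e h) R.iso.symm.op.symm

lemma gorenstein_of_iso_biprod (hξ : IsProperClass ξ)
    (h_sum : ∀ X Y : C, 𝒲 X → 𝒲 Y → 𝒲 (X ⊞ Y)) {G H H' : C} (hG : gorenstein ξ 𝒲 G)
    (e : G ≅ H ⊞ H') : gorenstein ξ 𝒲 H := by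
  obtain ⟨h₁, h₂⟩ := (gorenstein_iff hξ).1 hG
  have hconf : ∀ X Y : C, ExactConf ξ 𝒲 (biprod.inl : X ⟶ X ⊞ Y) biprod.snd := fun X Y =>
    (exactConf_iff hξ).2 ⟨0, binaryBiproductTriangle_distinguished X Y, .zero hξ _ _⟩
  let e' : G ≅ H' ⊞ H := e ≪≫ biprod.braiding H H'
  refine (gorenstein_iff hξ).2 ⟨?_, ?_⟩
  · exact (h₁.of_iso (fun e h => h.iso_comp hξ e) e.symm).of_split
      (inflationAxioms_exactConf hξ) (fun hA h => h.exists_retraction hξ hA)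
      (fun h hA hZ => h.prop_middle hξ h_sum hA hZ) (hconf H H') ⟨biprod.fst, by simp⟩
  · exact (h₂.of_iso (fun e h => ExactConf.op_iso_comp hξ e h) e'.symm.op.symm).of_split
      (inflationAxioms_opConf_exactConf hξ) (fun hA h => ExactConf.op_exists_retraction hξ hA h)
      (fun h hA hZ => ExactConf.prop_middle hξ h_sum h hZ hA)
      (x := (biprod.snd : H' ⊞ H ⟶ H).op) (y := (biprod.inl : H' ⟶ H' ⊞ H).op) (hconf H' H)
      ⟨(biprod.inr : H ⟶ H' ⊞ H).op, congrArg Quiver.Hom.op biprod.inr_snd⟩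

end

end Gorenstein

end RelGorenstein

theorem mainTheorem8 {C : Type u} [Category.{v} C] [Preadditive C] [HasZeroObject C]
    [HasShift C ℤ] [∀ n : ℤ, (shiftFunctor C n).Additive] [Pretriangulated C] [IsTriangulated C]
    (ξ : Set (Triangle C)) (hξ : RelGorenstein.IsProperClass ξ)
    (𝒲 : ObjectProperty C) (h_iso : 𝒲.IsClosedUnderIsomorphisms)
    (h_zero : 𝒲 (0 : C)) (h_sum : ∀ X Y : C, 𝒲 X → 𝒲 Y → 𝒲 (X ⊞ Y))
    (h_shift : 𝒲.IsStableUnderShift ℤ) :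
    (∀ n : ℕ, 1 ≤ n →
      RelGorenstein.gorensteinIter ξ 𝒲 n = RelGorenstein.gorenstein ξ 𝒲) ∧
    (∀ G H H' : C, RelGorenstein.gorenstein ξ 𝒲 G → (G ≅ H ⊞ H') →
      RelGorenstein.gorenstein ξ 𝒲 H) := by
  refine ⟨fun n hn => ?_, fun G H H' hG e =>
    RelGorenstein.gorenstein_of_iso_biprod hξ h_sum hG e⟩
  induction n, hn using Nat.le_induction with
  | base => rfl
  | succ n _ ih =>
    change RelGorenstein.gorenstein ξ (RelGorenstein.gorensteinIter ξ 𝒲 n) = _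
    rw [ih, RelGorenstein.gorenstein_gorenstein hξ h_zero h_sum]
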